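/- Consider the complex vector space $\wedge^3(\mathbb{C}^7)^*$ of alternating trilinear forms on $\mathbb{C}^7$, with its usual Euclidean topology, and the action of $\mathrm{GL}_7(\mathbb{C})$ on it given by $(f\cdot\Omega)(X,Y,Z)=\Omega(f^{-1}X,f^{-1}Y,f^{-1}Z)$. A form $\Omega\in\wedge^3(\mathbb{C}^7)^*$ is called generic if its orbit $\{f\cdot\Omega : f\in\mathrm{GL}_7(\mathbb{C})\}$ is an open subset of $\wedge^3(\mathbb{C}^7)^*$. Then there is exactly one $\mathrm{GL}_7(\mathbb{C})$-orbit of generic 3-forms in $\wedge^3(\mathbb{C}^7)^*$. A representative of it is the generic 3-form $$\Omega_0=-2\,\big(E_0^*\wedge E_1^*\wedge F_1^*+E_0^*\wedge E_2^*\wedge F_2^*+E_0^*\wedge E_3^*\wedge F_3^*\big)-4\,E_1^*\wedge E_2^*\wedge E_3^*+4\,F_1^*\wedge F_2^*\wedge F_3^*,$$ where $E_0,E_1,E_2,E_3,F_1,F_2,F_3$ is the canonical basis of $\mathbb{C}^7$, $E_0^*,\dots,F_3^*$ is its dual basis, and $(\xi_1\wedge\xi_2\wedge\xi_3)(X_1,X_2,X_3)=\det(\xi_i(X_j))$.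 -/

import Mathlib

namespace GenericForms

noncomputable section

/-- The space `∧ᵖ(ℂⁿ)*` of complex `p`-forms on `ℂⁿ`, that is, alternating `ℂ`-multilinear maps
`(ℂⁿ)ᵖ → ℂ` (all of which are continuous), with its usual (normed space) topology. -/
abbrev Form (n p : ℕ) : Type := (Fin n → ℂ) [⋀^Fin p]→L[ℂ] ℂ

/-- The group `GL_n(ℂ)` of invertible linear maps `ℂⁿ → ℂⁿ`. -/
abbrev GLn (n : ℕ) : Type := LinearMap.GeneralLinearGroup ℂ (Fin n → ℂ)

/-- A `ℂ`-linear endomorphism of `ℂⁿ`, viewed as a continuous linear map. -/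
abbrev toCLM {n : ℕ} (f : (Fin n → ℂ) →ₗ[ℂ] (Fin n → ℂ)) : (Fin n → ℂ) →L[ℂ] (Fin n → ℂ) :=
  LinearMap.toContinuousLinearMap f

/-- The left action of `GL_n(ℂ)` on `p`-forms,
`(f • Ω)(X₁, …, X_p) = Ω(f⁻¹ X₁, …, f⁻¹ X_p)`. -/
instance formAction (n p : ℕ) : MulAction (GLn n) (Form n p) where
  smul f Ω := Ω.compContinuousLinearMap (toCLM (↑(f⁻¹) : (Fin n → ℂ) →ₗ[ℂ] (Fin n → ℂ)))
  one_smul Ω := by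
    ext X
    change Ω (fun i => ((1 : GLn n)⁻¹ : GLn n).val (X i)) = Ω X
    simp
  mul_smul f g Ω := by
    ext X
    change Ω (fun i => ((f * g)⁻¹ : GLn n).val (X i)) =
      Ω (fun i => (g⁻¹ : GLn n).val ((f⁻¹ : GLn n).val (X i)))
    simp only [mul_inv_rev, Units.val_mul, Module.End.mul_apply]

theorem smul_form_apply {n p : ℕ} (f : GLn n) (Ω : Form n p) (X : Fin p → Fin n → ℂ) :
    (f • Ω) X = Ω (fun i => (f⁻¹ : GLn n).val (X i)) := rfl

/-- A `p`-form is generic when its orbit under `GL_n(ℂ)` is open in the space of `p`-forms. -/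
def IsGeneric {n p : ℕ} (Ω : Form n p) : Prop :=
  IsOpen (MulAction.orbit (GLn n) Ω)

/-- The wedge product of three linear forms,
`(ξ₀ ∧ ξ₁ ∧ ξ₂)(X₀, X₁, X₂) = det (ξⱼ(Xᵢ))`, see `wedge₃_apply`. -/
def wedge₃ {n : ℕ} (ξ₀ ξ₁ ξ₂ : (Fin n → ℂ) →L[ℂ] ℂ) : Form n 3 :=
  { (Matrix.detRowAlternating (n := Fin 3) (R := ℂ)).compLinearMap
      (LinearMap.pi fun j : Fin 3 => (![ξ₀, ξ₁, ξ₂] j).toLinearMap) with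
    cont := by
      change Continuous fun X : Fin 3 → Fin n → ℂ =>
        Matrix.det (Matrix.of fun i j : Fin 3 => (![ξ₀, ξ₁, ξ₂] j) (X i))
      refine Continuous.matrix_det (continuous_matrix fun i j => ?_)
      exact (![ξ₀, ξ₁, ξ₂] j).continuous.comp (continuous_apply i) }

theorem wedge₃_apply {n : ℕ} (ξ₀ ξ₁ ξ₂ : (Fin n → ℂ) →L[ℂ] ℂ) (X : Fin 3 → Fin n → ℂ) :
    wedge₃ ξ₀ ξ₁ ξ₂ X = Matrix.det !![ξ₀ (X 0), ξ₁ (X 0), ξ₂ (X 0);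
      ξ₀ (X 1), ξ₁ (X 1), ξ₂ (X 1); ξ₀ (X 2), ξ₁ (X 2), ξ₂ (X 2)] := by
  change Matrix.det (Matrix.of fun i j : Fin 3 => (![ξ₀, ξ₁, ξ₂] j) (X i)) = _
  congr 1
  ext i j
  fin_cases i <;> fin_cases j <;> rfl

/-- The `k`-th coordinate form `e_k*` on `ℂ⁷` (the dual basis of the canonical basis). -/
def coord (k : Fin 7) : (Fin 7 → ℂ) →L[ℂ] ℂ := ContinuousLinearMap.proj k

/- The canonical basis of `ℂ⁷` is written `E₀, E₁, E₂, E₃, F₁, F₂, F₃`, in this order, and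
`dualE₀, …, dualF₃` are the members `E₀*, …, F₃*` of its dual basis. -/

def dualE₀ : (Fin 7 → ℂ) →L[ℂ] ℂ := coord 0
def dualE₁ : (Fin 7 → ℂ) →L[ℂ] ℂ := coord 1
def dualE₂ : (Fin 7 → ℂ) →L[ℂ] ℂ := coord 2
def dualE₃ : (Fin 7 → ℂ) →L[ℂ] ℂ := coord 3
def dualF₁ : (Fin 7 → ℂ) →L[ℂ] ℂ := coord 4
def dualF₂ : (Fin 7 → ℂ) →L[ℂ] ℂ := coord 5
def dualF₃ : (Fin 7 → ℂ) →L[ℂ] ℂ := coord 6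

/-- The 3-form
`Ω₀ = -2 (E₀*∧E₁*∧F₁* + E₀*∧E₂*∧F₂* + E₀*∧E₃*∧F₃*) - 4 E₁*∧E₂*∧E₃* + 4 F₁*∧F₂*∧F₃*`. -/
def Ω₀ : Form 7 3 :=
  (-2 : ℂ) • (wedge₃ dualE₀ dualE₁ dualF₁ + wedge₃ dualE₀ dualE₂ dualF₂ + wedge₃ dualE₀ dualE₃ dualF₃)
    - (4 : ℂ) • wedge₃ dualE₁ dualE₂ dualE₃ + (4 : ℂ) • wedge₃ dualF₁ dualF₂ dualF₃

end

end GenericForms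

/-!
The argument is a linearization followed by a connectedness argument.

The derivative at the identity of `A ↦ Ω ∘ (A × ⋯ × A)` is the linear map
`infinitesimalAction Ω : End(ℂⁿ) → ∧ᵖ(ℂⁿ)*`. If it is surjective, the open mapping form of the
inverse function theorem shows that the orbit of `Ω` is a neighbourhood of `Ω`, and by homogeneity
the orbit is open (`isGeneric_of_surjective`).

Surjectivity of the linearization is generic along complex lines: if it holds at `Ω` and `R` is a
linear right inverse of the linearization there, then the linearization at `Ω + t Θ`, composed with
`R`, is `1 + t C` for a fixed endomorphism `C`, and this is invertible unless `-1/t` is an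
eigenvalue of `C` (`finite_not_surjective_line`). The complement of a finite set in `ℂ` is
connected and open orbits partition it into open sets, so all the forms of the line outside this
finite set lie in the orbit of `Ω`. Taking the line through `Ω` and another generic form `Ω'`,
whose open orbit contains all points of the line close to `Ω'`, gives `Ω' ∈ GL_n(ℂ) • Ω`
(`mem_orbit_of_isGeneric`).

It remains to see that the linearization at `Ω₀` is surjective. Applying it to the rank one
endomorphisms `x ↦ ξ(x) v` of `ℂ⁷` gives 49 short linear combinations of elementary 3-forms, and
a linear functional vanishing on all of them vanishes on every elementary 3-form
(`infinitesimalAction_Ω₀_surjective`).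
-/

namespace GenericForms

open Filter Topology

/-! ### Orbits and the linearized action -/

instance finiteDimensional_form (n p : ℕ) : FiniteDimensional ℂ (Form n p) :=
  Module.Finite.of_injective
    ((ContinuousMultilinearMap.toMultilinearMapLinear : _ →ₗ[ℂ] _).comp
      ContinuousAlternatingMap.toContinuousMultilinearMapLinear :
        Form n p →ₗ[ℂ] MultilinearMap ℂ (fun _ : Fin p => Fin n → ℂ) ℂ)
    (ContinuousMultilinearMap.toMultilinearMap_injective.comp
      ContinuousAlternatingMap.toContinuousMultilinearMap_injective)

/-- The linearization at the identity of the right action of endomorphisms on forms: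
`infinitesimalAction Ω A (X₁, …, X_p) = ∑ᵢ Ω(X₁, …, A Xᵢ, …, X_p)`. -/
noncomputable def infinitesimalAction {n p : ℕ} :
    Form n p →L[ℂ] ((Fin n → ℂ) →L[ℂ] (Fin n → ℂ)) →L[ℂ] Form n p :=
  ContinuousAlternatingMap.fderivCompContinuousLinearMapCLM ℂ (ContinuousLinearMap.id ℂ _)

theorem infinitesimalAction_apply {n p : ℕ} (Ω : Form n p)
    (A : (Fin n → ℂ) →L[ℂ] (Fin n → ℂ)) (X : Fin p → Fin n → ℂ) :
    infinitesimalAction Ω A X = ∑ i, Ω (Function.update X i (A (X i))) := by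
  simp only [infinitesimalAction,
    ContinuousAlternatingMap.fderivCompContinuousLinearMapCLM_apply,
    ContinuousAlternatingMap.fderivCompContinuousLinearMap_apply]
  refine Finset.sum_congr rfl fun i _ => congrArg Ω (funext fun j => ?_)
  by_cases h : j = i
  · subst h; simp
  · simp [h]

theorem compContinuousLinearMap_mem_orbit {n p : ℕ} (Ω : Form n p)
    (u : ((Fin n → ℂ) →L[ℂ] (Fin n → ℂ))ˣ) :
    Ω.compContinuousLinearMap (u : (Fin n → ℂ) →L[ℂ] (Fin n → ℂ)) ∈
      MulAction.orbit (GLn n) Ω := by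
  -- The action precomposes with the inverse, so the group element is `u⁻¹`.
  let g : GLn n := ⟨(u⁻¹).val.toLinearMap, u.val.toLinearMap,
    by rw [Module.End.mul_eq_comp, ← ContinuousLinearMap.toLinearMap_comp,
        ← ContinuousLinearMap.mul_def, Units.inv_mul]; rfl,
    by rw [Module.End.mul_eq_comp, ← ContinuousLinearMap.toLinearMap_comp,
        ← ContinuousLinearMap.mul_def, Units.mul_inv]; rfl⟩
  exact ⟨g, rfl⟩

theorem continuous_smul_form {n p : ℕ} (g : GLn n) :
    Continuous fun Ω : Form n p => g • Ω :=
  (ContinuousAlternatingMap.compContinuousLinearMapCLM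
    (toCLM (↑(g⁻¹) : (Fin n → ℂ) →ₗ[ℂ] (Fin n → ℂ)))).continuous

/-- The map `A ↦ Ω ∘ (A × ⋯ × A)` has derivative `infinitesimalAction Ω` at `1`, hence is open there,
and the invertible `A` form a neighbourhood of `1`. -/
theorem orbit_mem_nhds_of_surjective {n p : ℕ} {Ω : Form n p}
    (h : Function.Surjective (infinitesimalAction Ω)) :
    MulAction.orbit (GLn n) Ω ∈ 𝓝 Ω := by
  have hd := (hasStrictFDerivAt_const (𝕜 := ℂ) Ω
    (1 : (Fin n → ℂ) →L[ℂ] (Fin n → ℂ))).continuousAlternatingMapCompContinuousLinearMap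
    (hasStrictFDerivAt_id (1 : (Fin n → ℂ) →L[ℂ] (Fin n → ℂ)))
  have hmap := hd.map_nhds_eq_of_surj (by
    rw [LinearMap.range_eq_top]
    intro Θ
    obtain ⟨A, hA⟩ := h Θ
    refine ⟨A, ?_⟩
    rw [← hA]
    simp [infinitesimalAction]
    rfl)
  have hΩ : Ω.compContinuousLinearMap (id (1 : (Fin n → ℂ) →L[ℂ] (Fin n → ℂ))) = Ω := by
    ext X; rfl
  rw [hΩ] at hmap
  rw [← hmap, mem_map]
  filter_upwards [Units.isOpen.mem_nhds (isUnit_one (M := (Fin n → ℂ) →L[ℂ] (Fin n → ℂ)))]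
  rintro _ ⟨u, rfl⟩
  exact compContinuousLinearMap_mem_orbit Ω u

theorem isGeneric_of_surjective {n p : ℕ} {Ω : Form n p}
    (h : Function.Surjective (infinitesimalAction Ω)) : IsGeneric Ω := by
  refine isOpen_iff_mem_nhds.2 ?_
  rintro _ ⟨g, rfl⟩
  have hnhds : (fun Θ : Form n p => g⁻¹ • Θ) ⁻¹' MulAction.orbit (GLn n) Ω ∈ 𝓝 (g • Ω) :=
    (continuous_smul_form g⁻¹).continuousAt.preimage_mem_nhds
      (by rw [inv_smul_smul]; exact orbit_mem_nhds_of_surjective h)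
  filter_upwards [hnhds] with Θ hΘ
  obtain ⟨f, hf⟩ := hΘ
  exact ⟨g * f, (mul_smul g f Ω).trans ((smul_eq_iff_eq_inv_smul g).2 hf)⟩

/-! ### Two open orbits coincide -/

/-- Composed with a right inverse of its value at `t = 0`, the linearization along the line is
`1 + t C`, so that the exceptional `t` are among the `-1/μ` for `μ` an eigenvalue of `C`. -/
theorem finite_not_surjective_line {n p : ℕ} {Ω : Form n p}
    (h : Function.Surjective (infinitesimalAction Ω)) (Θ : Form n p) :
    {t : ℂ | ¬ Function.Surjective (infinitesimalAction (Ω + t • Θ))}.Finite := by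
  obtain ⟨R, hR⟩ := (infinitesimalAction Ω).toLinearMap.exists_rightInverse_of_surjective
    (LinearMap.range_eq_top.2 h)
  let C : Module.End ℂ (Form n p) := (infinitesimalAction Θ).toLinearMap.comp R
  refine (C.finite_hasEigenvalue.image fun μ => (-μ)⁻¹).subset fun t ht => ?_
  have hker : ∃ v : Form n p, v ≠ 0 ∧ v + t • C v = 0 := by
    by_contra! hinj
    refine ht fun Ψ => ?_
    have hsurj : Function.Surjective ((1 : Module.End ℂ (Form n p)) + t • C) :=
      LinearMap.injective_iff_surjective.1 <|
        (injective_iff_map_eq_zero _).2 fun v hv => by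
          by_contra hv0
          exact hinj v hv0 hv
    obtain ⟨v, rfl⟩ := hsurj Ψ
    refine ⟨R v, ?_⟩
    have hRv : infinitesimalAction Ω (R v) = v := LinearMap.congr_fun hR v
    simp [C, hRv]
  obtain ⟨v, hv, hCv⟩ := hker
  have ht0 : t ≠ 0 := by
    rintro rfl
    exact hv (by rwa [zero_smul ℂ (C v), add_zero] at hCv)
  refine ⟨-t⁻¹, Module.End.hasEigenvalue_of_hasEigenvector (x := v)
    ⟨Module.End.mem_eigenspace_iff.2 ?_, hv⟩, by simp⟩
  have hsmul : t⁻¹ • v + C v = 0 := by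
    rw [← inv_smul_smul₀ ht0 (C v), ← smul_add t⁻¹ v (t • C v), hCv, smul_zero t⁻¹]
  rw [neg_smul, eq_neg_iff_add_eq_zero, add_comm, hsmul]

/-- Orbits partition a set of generic forms into relatively open subsets, so a connected such set
meets only one of them. -/
theorem mem_orbit_of_isPreconnected {n p : ℕ} {S : Set (Form n p)} (hS : IsPreconnected S)
    (hgen : ∀ Ω ∈ S, IsGeneric Ω) {Ω Ω' : Form n p} (hΩ : Ω ∈ S) (hΩ' : Ω' ∈ S) :
    Ω' ∈ MulAction.orbit (GLn n) Ω := by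
  let V : Set (Form n p) :=
    ⋃ Θ ∈ S \ MulAction.orbit (GLn n) Ω, MulAction.orbit (GLn n) Θ
  refine hS.subset_left_of_subset_union (u := MulAction.orbit (GLn n) Ω) (v := V)
    (hgen Ω hΩ) (isOpen_biUnion fun Θ hΘ => hgen Θ hΘ.1) ?_ ?_
    ⟨Ω, hΩ, MulAction.mem_orbit_self Ω⟩ hΩ'
  · refine Set.disjoint_iUnion₂_right.2 fun Θ hΘ => Set.disjoint_left.2 fun Ψ h₁ h₂ => hΘ.2 ?_
    rw [← MulAction.orbit_eq_iff.2 h₁, MulAction.orbit_eq_iff.2 h₂]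
    exact MulAction.mem_orbit_self Θ
  · intro Θ hΘ
    by_cases h : Θ ∈ MulAction.orbit (GLn n) Ω
    · exact Or.inl h
    · exact Or.inr (Set.mem_biUnion ⟨hΘ, h⟩ (MulAction.mem_orbit_self Θ))

theorem mem_orbit_of_isGeneric {n p : ℕ} {Ω Ω' : Form n p}
    (h : Function.Surjective (infinitesimalAction Ω)) (h' : IsGeneric Ω') :
    Ω' ∈ MulAction.orbit (GLn n) Ω := by
  let γ : ℂ → Form n p := fun t => Ω + t • (Ω' - Ω)
  have hγ : Continuous γ := by fun_prop
  have hγ0 : γ 0 = Ω := by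
    simp only [γ, zero_smul ℂ (Ω' - Ω), add_zero]
  have hγ1 : γ 1 = Ω' := by simp [γ]
  let B : Set ℂ := {t | ¬ Function.Surjective (infinitesimalAction (γ t))}
  have hB : B.Countable := (finite_not_surjective_line h (Ω' - Ω)).countable
  have hconn : IsPreconnected (γ '' Bᶜ) :=
    (hB.isConnected_compl_of_one_lt_rank (by simp)).isPreconnected.image γ hγ.continuousOn
  -- Some point of the line, close to `Ω'`, lies in the orbit of `Ω'` and outside the finite set.
  obtain ⟨t, htB, ht⟩ : ∃ t ∈ Bᶜ, γ t ∈ MulAction.orbit (GLn n) Ω' :=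
    (hB.dense_compl ℝ).exists_mem_open (IsOpen.preimage hγ h')
      ⟨1, show γ 1 ∈ MulAction.orbit (GLn n) Ω' by rw [hγ1]; exact MulAction.mem_orbit_self Ω'⟩
  have hmem : γ t ∈ MulAction.orbit (GLn n) Ω := by
    refine mem_orbit_of_isPreconnected hconn ?_ ⟨0, ?_, hγ0⟩ ⟨t, htB, rfl⟩
    · rintro _ ⟨s, hs, rfl⟩
      exact isGeneric_of_surjective (not_not.1 hs)
    · simpa [B, hγ0] using h
  rw [← MulAction.orbit_eq_iff.2 hmem, MulAction.orbit_eq_iff.2 ht]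
  exact MulAction.mem_orbit_self Ω'

/-! ### Elementary 3-forms -/

/-- The form `e_i* ∧ e_j* ∧ e_k*` on `ℂ⁷`. -/
noncomputable abbrev elementary (i j k : Fin 7) : Form 7 3 := wedge₃ (coord i) (coord j) (coord k)

theorem form_apply_eq_sum {n p : ℕ} (Ω : Form n p) (X : Fin p → Fin n → ℂ) :
    Ω X = ∑ r : Fin p → Fin n, (∏ i, X i (r i)) * Ω fun i => Pi.single (r i) 1 := by
  have hX : X = fun i => ∑ k, X i k • (Pi.single k 1 : Fin n → ℂ) :=
    funext fun i => pi_eq_sum_univ' (X i)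
  conv_lhs => rw [hX]
  rw [ContinuousAlternatingMap.map_sum]
  exact Finset.sum_congr rfl fun r _ => Ω.map_smul_univ _ _

/-- Each coefficient of a 3-form is counted once for each of the six orderings of its indices. -/
theorem sum_elementary (Ω : Form 7 3) :
    ∑ r : Fin 3 → Fin 7, (Ω fun i => Pi.single (r i) 1) • elementary (r 0) (r 1) (r 2) =
      (6 : ℂ) • Ω := by
  ext X
  have hdet : ∀ r : Fin 3 → Fin 7, elementary (r 0) (r 1) (r 2) X =
      ∑ σ : Equiv.Perm (Fin 3), (Equiv.Perm.sign σ : ℂ) * ∏ i, X (σ i) (r i) := fun r => by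
    refine Eq.trans ?_ (Matrix.det_apply' (Matrix.of fun i j => X i (r j)))
    rw [wedge₃_apply]
    congr 1
    ext i j
    fin_cases i <;> fin_cases j <;> rfl
  simp only [ContinuousAlternatingMap.sum_apply, ContinuousAlternatingMap.smul_apply, hdet,
    smul_eq_mul, Finset.mul_sum]
  rw [Finset.sum_comm]
  have hσ : ∀ σ : Equiv.Perm (Fin 3), ∑ r : Fin 3 → Fin 7,
      (Ω fun i => Pi.single (r i) 1) * ((Equiv.Perm.sign σ : ℂ) * ∏ i, X (σ i) (r i)) = Ω X := by
    intro σ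
    have hperm : Ω (X ∘ σ) = (Equiv.Perm.sign σ : ℂ) * Ω X := by
      refine (Ω.toAlternatingMap.map_perm X σ).trans ?_
      rw [Units.smul_def, zsmul_eq_mul]
      rfl
    have hsq : (Equiv.Perm.sign σ : ℂ) * (Equiv.Perm.sign σ : ℂ) = 1 := by
      norm_cast
      simp
    calc _ = (Equiv.Perm.sign σ : ℂ) * Ω (X ∘ σ) := by
          rw [form_apply_eq_sum, Finset.mul_sum]
          exact Finset.sum_congr rfl fun r _ => by simp only [Function.comp_apply]; ring
      _ = Ω X := by rw [hperm, ← mul_assoc, hsq, one_mul]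
  simp only [hσ, Finset.sum_const, Finset.card_univ, Fintype.card_perm, Fintype.card_fin,
    nsmul_eq_mul]
  norm_num [Nat.factorial]

theorem wedge₃_swap_left {n : ℕ} (a b c : (Fin n → ℂ) →L[ℂ] ℂ) :
    wedge₃ b a c = -wedge₃ a b c := by
  ext X
  simp only [wedge₃_apply, Matrix.det_fin_three, ContinuousAlternatingMap.neg_apply]
  simp
  ring

theorem wedge₃_swap_right {n : ℕ} (a b c : (Fin n → ℂ) →L[ℂ] ℂ) :
    wedge₃ a c b = -wedge₃ a b c := by
  ext X
  simp only [wedge₃_apply, Matrix.det_fin_three, ContinuousAlternatingMap.neg_apply]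
  simp
  ring

/-- Rank one endomorphisms act on a product of linear forms as derivations. -/
theorem infinitesimalAction_wedge₃_smulRight {n : ℕ} (a b c ξ : (Fin n → ℂ) →L[ℂ] ℂ)
    (v : Fin n → ℂ) :
    infinitesimalAction (wedge₃ a b c) (ξ.smulRight v) =
      a v • wedge₃ ξ b c + b v • wedge₃ a ξ c + c v • wedge₃ a b ξ := by
  ext X
  simp [infinitesimalAction_apply, wedge₃_apply, Matrix.det_fin_three, Fin.sum_univ_three,
    Function.update]
  ring

/-! ### The form `Ω₀` -/

/-- The linearized action on `Ω₀` of the rank one endomorphism `x ↦ x_b e_a`. -/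
theorem infinitesimalAction_Ω₀_single (a b : Fin 7) :
    infinitesimalAction Ω₀ ((coord b).smulRight (Pi.single a 1)) =
      (-2 : ℂ) • (((Pi.single a 1 : Fin 7 → ℂ) 0 • elementary b 1 4
            + (Pi.single a 1 : Fin 7 → ℂ) 1 • elementary 0 b 4
            + (Pi.single a 1 : Fin 7 → ℂ) 4 • elementary 0 1 b)
          + ((Pi.single a 1 : Fin 7 → ℂ) 0 • elementary b 2 5
            + (Pi.single a 1 : Fin 7 → ℂ) 2 • elementary 0 b 5
            + (Pi.single a 1 : Fin 7 → ℂ) 5 • elementary 0 2 b)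
          + ((Pi.single a 1 : Fin 7 → ℂ) 0 • elementary b 3 6
            + (Pi.single a 1 : Fin 7 → ℂ) 3 • elementary 0 b 6
            + (Pi.single a 1 : Fin 7 → ℂ) 6 • elementary 0 3 b))
        - (4 : ℂ) • ((Pi.single a 1 : Fin 7 → ℂ) 1 • elementary b 2 3
            + (Pi.single a 1 : Fin 7 → ℂ) 2 • elementary 1 b 3
            + (Pi.single a 1 : Fin 7 → ℂ) 3 • elementary 1 2 b)
        + (4 : ℂ) • ((Pi.single a 1 : Fin 7 → ℂ) 4 • elementary b 5 6
            + (Pi.single a 1 : Fin 7 → ℂ) 5 • elementary 4 b 6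
            + (Pi.single a 1 : Fin 7 → ℂ) 6 • elementary 4 5 b) := by
  simp only [Ω₀, map_add, map_sub, map_smul, _root_.add_apply,
    _root_.sub_apply, _root_.smul_apply,
    infinitesimalAction_wedge₃_smulRight]
  rfl

/-- The 49 relations coming from the rank one endomorphisms `x ↦ x_b e_a` leave no room for a
nonzero alternating family of coefficients. -/
theorem alternating_eq_zero_of_relations {P : Fin 7 → Fin 7 → Fin 7 → ℂ}
    (hl : ∀ i j k, P j i k = -P i j k) (hr : ∀ i j k, P i k j = -P i j k)
    (h0 : ∀ b, P b 1 4 + P b 2 5 + P b 3 6 = 0)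
    (h1 : ∀ b, P 0 b 4 + 2 * P b 2 3 = 0) (h2 : ∀ b, P 0 b 5 + 2 * P 1 b 3 = 0)
    (h3 : ∀ b, P 0 b 6 + 2 * P 1 2 b = 0) (h4 : ∀ b, P 0 1 b - 2 * P b 5 6 = 0)
    (h5 : ∀ b, P 0 2 b - 2 * P 4 b 6 = 0) (h6 : ∀ b, P 0 3 b - 2 * P 4 5 b = 0)
    (i j k : Fin 7) : P i j k = 0 := by
  -- The relations consisting of a single nonzero term.
  have hE : P 0 1 2 = 0 ∧ P 0 1 3 = 0 ∧ P 0 2 3 = 0 := by grind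
  have hF : P 0 4 5 = 0 ∧ P 0 4 6 = 0 ∧ P 0 5 6 = 0 := by grind
  have hEF : P 0 1 5 = 0 ∧ P 0 1 6 = 0 ∧ P 0 2 4 = 0 ∧ P 0 2 6 = 0 ∧ P 0 3 4 = 0 ∧
      P 0 3 5 = 0 := by grind
  have hEEF : P 2 3 4 = 0 ∧ P 1 3 5 = 0 ∧ P 1 2 6 = 0 := by grind
  have hEFF : P 1 5 6 = 0 ∧ P 2 4 6 = 0 ∧ P 3 4 5 = 0 := by grind
  -- The relations with two terms, one of which is already known to vanish.
  have hEEF' : P 1 2 4 = 0 ∧ P 1 2 5 = 0 ∧ P 1 3 4 = 0 ∧ P 1 3 6 = 0 ∧ P 2 3 5 = 0 ∧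
      P 2 3 6 = 0 := by grind
  have hEFF' : P 1 4 5 = 0 ∧ P 1 4 6 = 0 ∧ P 2 4 5 = 0 ∧ P 2 5 6 = 0 ∧ P 3 4 6 = 0 ∧
      P 3 5 6 = 0 := by grind
  -- The coefficients `P 0 1 4`, `P 0 2 5`, `P 0 3 6` are equal and have sum zero.
  have hdiag : P 0 1 4 = 0 ∧ P 0 2 5 = 0 ∧ P 0 3 6 = 0 := by grind
  have hvol : P 1 2 3 = 0 ∧ P 4 5 6 = 0 := by grind
  have hlt : ∀ i j k, i < j → j < k → P i j k = 0 := by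
    clear h0 h1 h2 h3 h4 h5 h6 hl hr
    intro i j k hij hjk
    fin_cases i <;> fin_cases j <;> first
      | exact absurd hij (by decide)
      | (fin_cases k <;> first
          | exact absurd hjk (by decide)
          | (simp only [Fin.reduceFinMk, Fin.zero_eta, Fin.mk_one]; tauto))
  clear h0 h1 h2 h3 h4 h5 h6
  grind

theorem infinitesimalAction_Ω₀_surjective : Function.Surjective (infinitesimalAction Ω₀) := by
  refine (LinearMap.range_eq_top (f := (infinitesimalAction Ω₀).toLinearMap)).1 ?_
  by_contra hne
  obtain ⟨ψ, hψ0, hψ⟩ := Submodule.exists_le_ker_of_lt_top _ (lt_top_iff_ne_top.2 hne)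
  have hrel : ∀ a b, ψ (infinitesimalAction Ω₀ ((coord b).smulRight (Pi.single a 1))) = 0 :=
    fun a b => hψ ⟨_, rfl⟩
  simp only [infinitesimalAction_Ω₀_single, map_add, map_sub, map_smul, smul_eq_mul] at hrel
  have hP : ∀ i j k, ψ (elementary i j k) = 0 := by
    refine alternating_eq_zero_of_relations (P := fun i j k => ψ (elementary i j k))
      (fun i j k => by rw [elementary, wedge₃_swap_left, map_neg])
      (fun i j k => by rw [elementary, wedge₃_swap_right, map_neg])
      (fun b => ?_) (fun b => ?_) (fun b => ?_) (fun b => ?_) (fun b => ?_) (fun b => ?_)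
      (fun b => ?_)
    · have := hrel 0 b
      simp at this
      linear_combination this
    · have := hrel 1 b
      simp at this
      linear_combination (-1 / 2 : ℂ) * this
    · have := hrel 2 b
      simp at this
      linear_combination (-1 / 2 : ℂ) * this
    · have := hrel 3 b
      simp at this
      linear_combination (-1 / 2 : ℂ) * this
    · have := hrel 4 b
      simp at this
      linear_combination (-1 / 2 : ℂ) * this
    · have := hrel 5 b
      simp at this
      linear_combination (-1 / 2 : ℂ) * this
    · have := hrel 6 b
      simp at this
      linear_combination (-1 / 2 : ℂ) * this
  refine hψ0 (LinearMap.ext fun Ω => ?_)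
  have hΩ := congrArg ψ (sum_elementary Ω)
  simp only [map_sum, map_smul, hP, smul_zero, Finset.sum_const_zero] at hΩ
  simpa using hΩ.symm

end GenericForms

/-- There is exactly one `GL₇(ℂ)`-orbit of generic 3-forms in `∧³(ℂ⁷)*`, and `Ω₀` is generic, so
that it is a representative of that orbit. -/
theorem mainTheorem1 :
    (∃! O : Set (GenericForms.Form 7 3), ∃ Ω : GenericForms.Form 7 3,
      GenericForms.IsGeneric Ω ∧ O = MulAction.orbit (GenericForms.GLn 7) Ω) ∧
    GenericForms.IsGeneric GenericForms.Ω₀ := by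
  have hsurj := GenericForms.infinitesimalAction_Ω₀_surjective
  have hgen := GenericForms.isGeneric_of_surjective hsurj
  refine ⟨⟨_, ⟨GenericForms.Ω₀, hgen, rfl⟩, ?_⟩, hgen⟩
  rintro _ ⟨Ω, hΩ, rfl⟩
  exact MulAction.orbit_eq_iff.2 (GenericForms.mem_orbit_of_isGeneric hsurj hΩ)
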